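/- Let $(M,\mathcal T,\Phi)$ be a weighted triangulated surface: $M$ is a closed connected surface with a (finite, simplicial) triangulation $\mathcal T=(V,E,F)$, $V=\{1,\dots,N\}$, and $\Phi:E\to[0,\pi/2]$ is a weight $\Phi_{ij}$ on the edges. A circle packing metric is a function $r:V\to(0,\infty)$, i.e. $r\in\mathbb R^N_{>0}$. It gives each edge $\{i,j\}$ the length $l_{ij}=\sqrt{r_i^2+r_j^2+2r_ir_j\cos\Phi_{ij}}$. Let $\theta_i^{jk}$ be the inner angle at $i$ of the Euclidean triangle with side lengths $l_{ij},l_{jk},l_{ik}$, for each face $\{i,j,k\}\in F$, and let $K_i=K_i(r)=2\pi-\sum_{\{i,j,k\}\in F}\theta_i^{jk}$, where the sum runs over the faces that contain $i$. For $\alpha\in\mathbb R$ the $\alpha$-curvature of $r$ at $i$ is $R_{\alpha,i}=K_i/r_i^{\alpha}$. Let $\alpha\in\mathbb R$ and $\overline R:V\to\mathbb R$ be such that $\alpha\overline R_i\le 0$ for all $i\in V$ and $\alpha\overline R$ is not identically zero. Suppose that $\overline R$ is the $\alpha$-curvature of some circle packing metric $\overline r$. Then: 1. $\overline r$ is the unique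 circle packing metric in $\mathbb R^N_{>0}$ whose $\alpha$-curvature is $\overline R$. 2. For every initial circle packing metric $r(0)\in\mathbb R^N_{>0}$, the modified $\alpha$-flow $$\frac{du_i}{dt}=\overline R_i\,r_i^{\alpha}-K_i,\qquad u_i=\ln r_i,$$ has a solution $r(t)\in\mathbb R^N_{>0}$ defined for all $t\ge 0$, and every such solution converges exponentially fast to $\overline r$: there are constants $C$ and $c>0$ (which may depend on the solution) such that $|r_i(t)-\overline r_i|\le C e^{-ct}$ for all $t\ge 0$ and all $i\in V$. -/

import Mathlib

/-- A triangulated closed connected surface with finite vertex set `V`: a finite abstract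
simplicial complex of dimension at most two with connected one-skeleton, in which every edge lies
in exactly two triangles and the link of every vertex is connected. (The link of a vertex is then
a finite connected graph all of whose degrees are two, that is, a cycle.) -/
structure TriangulatedSurface (V : Type*) [Fintype V] [DecidableEq V] extends
    AbstractSimplicialComplex V where
  /-- there are no simplices of dimension three or more -/
  card_le_three : ∀ s ∈ faces, s.card ≤ 3
  /-- every edge lies in exactly two triangles -/
  edge_two_triangles : ∀ i j : V, i ≠ j → {i, j} ∈ faces →
    {k : V | k ≠ i ∧ k ≠ j ∧ {i, j, k} ∈ faces}.ncard = 2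
  /-- the link of every vertex is connected (and nonempty) -/
  link_connected : ∀ i : V,
    (SimpleGraph.fromRel (fun j k : {j : V // i ≠ j ∧ {i, j} ∈ faces} =>
      {i, (j : V), (k : V)} ∈ faces)).Connected
  /-- the surface is connected (and nonempty) -/
  connected : (SimpleGraph.fromRel (fun i j : V => {i, j} ∈ faces)).Connected

/-- A weighted triangulated surface: every edge `{i, j}` carries a weight
`Φ i j = Φ j i` in `[0, π / 2]`. The value of `weight` at unordered pairs that are not edges is
never used. -/
structure WeightedTriangulatedSurface (V : Type*) [Fintype V] [DecidableEq V] extends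
    TriangulatedSurface V where
  /-- the weight function on edges -/
  weight : Sym2 V → ℝ
  weight_mem : ∀ i j : V, i ≠ j → {i, j} ∈ faces → weight s(i, j) ∈ Set.Icc 0 (Real.pi / 2)

namespace WeightedTriangulatedSurface

variable {V : Type*} [Fintype V] [DecidableEq V] (T : WeightedTriangulatedSurface V)

/-- `{i, j, k}` is a triangle (two-dimensional face) of the triangulation. -/
def IsTriangle (i j k : V) : Prop :=
  i ≠ j ∧ i ≠ k ∧ j ≠ k ∧ {i, j, k} ∈ T.faces

/-- A circle packing metric: a positive function on the vertices. -/
def IsCirclePackingMetric (r : V → ℝ) : Prop :=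
  ∀ i, 0 < r i

/-- The length `l_ij` of the edge `{i, j}`. -/
noncomputable def edgeLength (r : V → ℝ) (i j : V) : ℝ :=
  Real.sqrt (r i ^ 2 + r j ^ 2 + 2 * r i * r j * Real.cos (T.weight s(i, j)))

/-- The inner angle at `i` of the Euclidean triangle with side lengths `l_ij`, `l_ik`, `l_jk`,
by the law of cosines. -/
noncomputable def innerAngle (r : V → ℝ) (i j k : V) : ℝ :=
  Real.arccos ((T.edgeLength r i j ^ 2 + T.edgeLength r i k ^ 2 - T.edgeLength r j k ^ 2) /
    (2 * T.edgeLength r i j * T.edgeLength r i k))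

open Classical in
/-- The classical discrete Gauss curvature `K_i`: the angle deficit `2π` minus the sum of the
angles at `i` over all triangles containing `i`. The double sum runs over ordered pairs `(j, k)`
and so counts each triangle `{i, j, k}` twice; this is the reason for the factor `1 / 2`. -/
noncomputable def gaussCurvature (r : V → ℝ) (i : V) : ℝ :=
  2 * Real.pi -
    (1 / 2) * ∑ j : V, ∑ k : V, if T.IsTriangle i j k then T.innerAngle r i j k else 0

/-- The discrete Gauss curvature of order `α` (`α`-curvature) `K_i / r_i ^ α`. -/
noncomputable def alphaCurvature (α : ℝ) (r : V → ℝ) (i : V) : ℝ :=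
  T.gaussCurvature r i / r i ^ α

/-- `r` is a solution for all times `t ≥ 0` of the modified `α`-flow with respect to `R`,
`du_i/dt = R_i r_i ^ α - K_i` with `u_i = ln r_i` (one-sided derivative at `t = 0`). -/
structure IsModifiedAlphaFlow (α : ℝ) (R : V → ℝ) (r : ℝ → V → ℝ) : Prop where
  metric : ∀ t, 0 ≤ t → IsCirclePackingMetric (r t)
  flow : ∀ t, 0 ≤ t → ∀ i,
    HasDerivWithinAt (fun s => Real.log (r s i))
      (R i * r t i ^ α - T.gaussCurvature (r t) i) (Set.Ici 0) t

end WeightedTriangulatedSurface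

/-! In the coordinates `u i = log (r i)` the flow is the autonomous system `u' = F u` with `F =
alphaField`, and metrics of curvature `R` give zeros of `F`. Everything follows from negative
definiteness of the derivative of `F` at every point.

The angles are invariant under scaling, and `∂θ_i/∂u_j = ∂θ_j/∂u_i` in each triangle. Hence the
derivative of the curvature has as quadratic form a Dirichlet form, a sum of terms `angleCoeff * (w
i - w j) ^ 2`. Weights in `[0, π / 2]` make the coefficients nonnegative, and by connectedness the
form vanishes only on constant `w`. The other part of `F` contributes the sum of `α R_i r_i ^ α w_i
^ 2`, which is nonpositive and excludes nonzero constants.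

Consequently `⟪F u - F p, u - p⟫ < 0` for `u ≠ p`. This gives uniqueness of the zero `p`, and it
keeps trajectories in a ball around `p`, hence global existence. Compactness of the ball makes the
inequality quantitative, hence exponential decay. -/

open Set Metric Filter Topology
open scoped NNReal RealInnerProductSpace

/-! ### Global solutions for bounded Lipschitz fields. -/

section AutonomousODE

variable {E : Type*} [NormedAddCommGroup E] [NormedSpace ℝ E] [CompleteSpace E]

/-- A bounded Lipschitz vector field on a Banach space is complete. -/
theorem exists_forall_hasDerivAt_of_lipschitzWith_of_bounded {G : E → E} {K L : ℝ≥0}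
    (hG : LipschitzWith K G) (hL : ∀ x, ‖G x‖ ≤ L) (x₀ : E) :
    ∃ γ : ℝ → E, γ 0 = x₀ ∧ ∀ t, HasDerivAt γ (G (γ t)) t := by
  have local_sol : ∀ a : ℝ, ∃ γ : ℝ → E, 0 < a → (γ 0 = x₀ ∧
      ∀ t ∈ Ioo (-a) a, HasDerivAt γ (G (γ t)) t) := by
    intro a
    by_cases ha : 0 < a
    swap
    · exact ⟨fun _ => x₀, fun h => absurd h ha⟩
    have h0 : (0 : ℝ) ∈ Icc (-a) a := ⟨by linarith, ha.le⟩
    -- Speed at most `L` cannot leave the ball of radius `L * a` within time `a`, so no smallness of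
    -- `a` is needed.
    have hpl : IsPicardLindelof (fun _ : ℝ => G) (⟨0, h0⟩ : Icc (-a) a) x₀
        (L * a.toNNReal) 0 L K :=
      { lipschitzOnWith := fun _ _ => hG.lipschitzOnWith
        continuousOn := fun _ _ => continuousOn_const
        norm_le := fun _ _ x _ => hL x
        mul_max_le := by simp [ha.le] }
    obtain ⟨γ, h1, h2⟩ := hpl.exists_eq_forall_mem_Icc_hasDerivWithinAt₀
    exact ⟨γ, fun _ => ⟨h1, fun t ht => (h2 t (Ioo_subset_Icc_self ht)).hasDerivAt
      (Icc_mem_nhds ht.1 ht.2)⟩⟩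
  choose γ hγ using local_sol
  have heq : ∀ a b : ℝ, 0 < a → a ≤ b → EqOn (γ a) (γ b) (Ioo (-a) a) := by
    intro a b ha hab
    have hb : 0 < b := ha.trans_le hab
    refine ODE_solution_unique_of_mem_Ioo (v := fun _ => G) (s := fun _ => univ) (K := K) (t₀ := 0)
      (fun _ _ => hG.lipschitzOnWith) ⟨by linarith, ha⟩
      (fun t ht => ⟨(hγ a ha).2 t ht, mem_univ _⟩)
      (fun t ht => ⟨(hγ b hb).2 t ⟨by linarith [ht.1], by linarith [ht.2]⟩, mem_univ _⟩) ?_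
    rw [(hγ a ha).1, (hγ b hb).1]
  refine ⟨fun t => γ (|t| + 1) t, by simpa using (hγ 1 one_pos).1, fun t => ?_⟩
  have hpos : 0 < |t| + 2 := by positivity
  have ht : t ∈ Ioo (-(|t| + 1)) (|t| + 1) := abs_lt.mp (lt_add_one _)
  -- Near `t` the glued curve must agree with one fixed solution; `|t| + 2` exceeds every `|s| + 1`
  -- that occurs.
  have key : ∀ s ∈ Ioo (-(|t| + 1)) (|t| + 1), γ (|s| + 1) s = γ (|t| + 2) s := by
    intro s hs
    have hs' := abs_lt.mpr hs
    exact heq _ _ (by positivity) (by linarith) (abs_lt.mp (lt_add_one _))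
  have hd := (hγ _ hpos).2 t ⟨by linarith [ht.1], by linarith [ht.2]⟩
  simp only [key t ht]
  exact hd.congr_of_eventuallyEq (eventually_of_mem (Ioo_mem_nhds ht.1 ht.2) key)

end AutonomousODE

/-! ### Dynamics of fields with negative definite derivative. -/

section NegativeDefinite

variable {E : Type*} [NormedAddCommGroup E] [InnerProductSpace ℝ E]

/-- If a curve is pulled towards `p` at rate `c`, then it approaches `p` exponentially fast. -/
theorem norm_sub_sq_le_of_inner_deriv_le {γ v : ℝ → E} {p : E} {c : ℝ}
    (hγ : ∀ t, 0 ≤ t → HasDerivWithinAt γ (v t) (Ici 0) t)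
    (hv : ∀ t, 0 ≤ t → ⟪v t, γ t - p⟫ ≤ -c * ‖γ t - p‖ ^ 2) {t : ℝ} (ht : 0 ≤ t) :
    ‖γ t - p‖ ^ 2 ≤ ‖γ 0 - p‖ ^ 2 * Real.exp (-(2 * c) * t) := by
  have hd : ∀ s, 0 ≤ s → HasDerivWithinAt (fun s => ‖γ s - p‖ ^ 2 * Real.exp (2 * c * s))
      (2 * ⟪γ s - p, v s⟫ * Real.exp (2 * c * s)
        + ‖γ s - p‖ ^ 2 * (Real.exp (2 * c * s) * (2 * c))) (Ici 0) s := by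
    intro s hs
    have h1 := ((hγ s hs).sub_const p).norm_sq
    have h2 : HasDerivWithinAt (fun s : ℝ => Real.exp (2 * c * s))
        (Real.exp (2 * c * s) * (2 * c)) (Ici 0) s := by
      simpa using (((hasDerivAt_id s).const_mul (2 * c)).exp).hasDerivWithinAt
    exact h1.mul h2
  -- Grönwall with an integrating factor. The sign of `c` is free; `c = 0` shows that the distance
  -- to `p` does not grow.
  have hanti : AntitoneOn (fun s => ‖γ s - p‖ ^ 2 * Real.exp (2 * c * s)) (Ici 0) := by
    refine antitoneOn_of_hasDerivWithinAt_nonpos (convex_Ici 0)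
      (fun s hs => (hd s hs).continuousWithinAt)
      (fun s hs => (hd s (interior_subset hs)).mono interior_subset) fun s hs => ?_
    have h := hv s (interior_subset hs)
    rw [real_inner_comm] at h
    have he := Real.exp_pos (2 * c * s)
    nlinarith
  have := hanti self_mem_Ici ht ht
  simp only [mul_zero, Real.exp_zero, mul_one] at this
  calc ‖γ t - p‖ ^ 2 = ‖γ t - p‖ ^ 2 * Real.exp (2 * c * t) * Real.exp (-(2 * c) * t) := by
        rw [mul_assoc, ← Real.exp_add]; simp
    _ ≤ _ := by gcongr

/-- Pairing with the fixed vector `u - p` reduces to the scalar mean value theorem on the segment.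
-/
theorem exists_inner_sub_eq_inner_fderiv {F : E → E} (hF : Differentiable ℝ F) (u p : E) :
    ∃ ξ ∈ segment ℝ p u, ⟪F u - F p, u - p⟫ = ⟪fderiv ℝ F ξ (u - p), u - p⟫ := by
  have hd : ∀ t : ℝ, HasDerivAt (fun t : ℝ => ⟪F (p + t • (u - p)), u - p⟫)
      ⟪fderiv ℝ F (p + t • (u - p)) (u - p), u - p⟫ t := by
    intro t
    have h1 : HasDerivAt (fun t : ℝ => p + t • (u - p)) (u - p) t := by
      simpa using ((hasDerivAt_id t).smul_const (u - p)).const_add p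
    have h2 := (hF (p + t • (u - p))).hasFDerivAt.comp_hasDerivAt t h1
    simpa using h2.inner ℝ (hasDerivAt_const t (u - p))
  obtain ⟨t, ht, h⟩ := exists_hasDerivAt_eq_slope _ _ (zero_lt_one (α := ℝ))
    (fun t _ => (hd t).continuousAt.continuousWithinAt) (fun t _ => hd t)
  refine ⟨p + t • (u - p), ?_, ?_⟩
  · rw [segment_eq_image']
    exact ⟨t, Ioo_subset_Icc_self ht, rfl⟩
  · rw [h, inner_sub_left]; simp

/-- A vector field with negative definite derivative is strictly monotone. -/
theorem inner_sub_neg_of_fderiv_neg {F : E → E} (hF : Differentiable ℝ F)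
    (hneg : ∀ u w, w ≠ 0 → ⟪fderiv ℝ F u w, w⟫ < 0) {u p : E} (h : u ≠ p) :
    ⟪F u - F p, u - p⟫ < 0 := by
  obtain ⟨ξ, -, hξ⟩ := exists_inner_sub_eq_inner_fderiv hF u p
  exact hξ ▸ hneg ξ _ (sub_ne_zero.mpr h)

/-- By compactness the quadratic form has a negative maximum over the ball times the unit sphere;
the mean value point stays in the ball by convexity. -/
theorem exists_forall_inner_sub_le [FiniteDimensional ℝ E] {F : E → E} (hF : ContDiff ℝ 1 F)
    (hneg : ∀ u w, w ≠ 0 → ⟪fderiv ℝ F u w, w⟫ < 0) (p : E) (ρ : ℝ) :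
    ∃ c : ℝ, 0 < c ∧ ∀ u ∈ closedBall p ρ, ⟪F u - F p, u - p⟫ ≤ -c * ‖u - p‖ ^ 2 := by
  obtain ⟨c, hc, hcb⟩ : ∃ c : ℝ, 0 < c ∧ ∀ u ∈ closedBall p ρ, ∀ w ∈ sphere (0 : E) 1,
      ⟪fderiv ℝ F u w, w⟫ ≤ -c := by
    have hcomp : IsCompact (closedBall p ρ ×ˢ sphere (0 : E) 1) :=
      (isCompact_closedBall p ρ).prod (isCompact_sphere 0 1)
    have hcont : Continuous fun x : E × E => ⟪fderiv ℝ F x.1 x.2, x.2⟫ :=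
      (((hF.continuous_fderiv one_ne_zero).comp continuous_fst).clm_apply continuous_snd).inner
        continuous_snd
    rcases (closedBall p ρ ×ˢ sphere (0 : E) 1).eq_empty_or_nonempty with he | hne
    · refine ⟨1, one_pos, fun u hu w hw => ?_⟩
      exact absurd (mk_mem_prod hu hw) (by simp [he])
    · obtain ⟨x, hx, hmax⟩ := hcomp.exists_isMaxOn hne hcont.continuousOn
      have hx2 : x.2 ≠ 0 := ne_of_mem_sphere hx.2 one_ne_zero
      refine ⟨_, neg_pos.mpr (hneg x.1 x.2 hx2), fun u hu w hw => ?_⟩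
      rw [neg_neg]
      exact hmax (mk_mem_prod hu hw)
  refine ⟨c, hc, fun u hu => ?_⟩
  rcases eq_or_ne u p with rfl | hup
  · simp
  obtain ⟨ξ, hξ, h⟩ := exists_inner_sub_eq_inner_fderiv (hF.differentiable one_ne_zero) u p
  have hρ : 0 ≤ ρ := dist_nonneg.trans (mem_closedBall.mp hu)
  have hξ' : ξ ∈ closedBall p ρ :=
    (convex_closedBall p ρ).segment_subset (mem_closedBall_self hρ) hu hξ
  have hw : 0 < ‖u - p‖ := norm_pos_iff.mpr (sub_ne_zero.mpr hup)
  have hb := hcb ξ hξ' (‖u - p‖⁻¹ • (u - p)) (by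
    rw [mem_sphere_zero_iff_norm, norm_smul, norm_inv, norm_norm, inv_mul_cancel₀ hw.ne'])
  rw [h]
  simp only [map_smul, real_inner_smul_left, real_inner_smul_right] at hb
  calc _ = ‖u - p‖⁻¹ * (‖u - p‖⁻¹ * ⟪fderiv ℝ F ξ (u - p), u - p⟫) * ‖u - p‖ ^ 2 := by
        field_simp
    _ ≤ -c * ‖u - p‖ ^ 2 := by gcongr

/-- Every trajectory of a vector field with negative definite derivative converges exponentially
fast to its zero. -/
theorem exists_norm_sub_le_exp [FiniteDimensional ℝ E] {F : E → E} (hF : ContDiff ℝ 1 F)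
    (hneg : ∀ u w, w ≠ 0 → ⟪fderiv ℝ F u w, w⟫ < 0) {p : E} (hp : F p = 0) {γ : ℝ → E}
    (hγ : ∀ t, 0 ≤ t → HasDerivWithinAt γ (F (γ t)) (Ici 0) t) :
    ∃ c : ℝ, 0 < c ∧ ∀ t, 0 ≤ t → ‖γ t - p‖ ≤ ‖γ 0 - p‖ * Real.exp (-c * t) := by
  have hmono : ∀ u, ⟪F u, u - p⟫ ≤ 0 := by
    intro u
    rcases eq_or_ne u p with rfl | h
    · simp
    · simpa [hp] using (inner_sub_neg_of_fderiv_neg (hF.differentiable one_ne_zero) hneg h).le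
  -- Confinement comes first, because the rate `c` is uniform only on a compact ball.
  have hball : ∀ t, 0 ≤ t → γ t ∈ closedBall p ‖γ 0 - p‖ := by
    intro t ht
    have := norm_sub_sq_le_of_inner_deriv_le (p := p) (c := 0) hγ
      (fun t _ => by simpa using hmono (γ t)) ht
    rw [mem_closedBall, dist_eq_norm]
    exact (sq_le_sq₀ (norm_nonneg _) (norm_nonneg _)).mp (by simpa using this)
  obtain ⟨c, hc, hcb⟩ := exists_forall_inner_sub_le hF hneg p ‖γ 0 - p‖
  refine ⟨c, hc, fun t ht => ?_⟩
  have := norm_sub_sq_le_of_inner_deriv_le (p := p) (c := c) hγ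
    (fun t ht => by simpa [hp] using hcb _ (hball t ht)) ht
  refine (sq_le_sq₀ (norm_nonneg _) (by positivity)).mp (this.trans_eq ?_)
  rw [mul_pow, ← Real.exp_nat_mul]
  congr 2
  push_cast
  ring

/-- A `C¹` vector field with negative definite derivative and a zero has trajectories for all
positive times. -/
theorem exists_forall_hasDerivWithinAt_Ici [FiniteDimensional ℝ E] {F : E → E}
    (hF : ContDiff ℝ 1 F) (hneg : ∀ u w, w ≠ 0 → ⟪fderiv ℝ F u w, w⟫ < 0) {p : E} (hp : F p = 0)
    (x₀ : E) :
    ∃ γ : ℝ → E, γ 0 = x₀ ∧ ∀ t, 0 ≤ t → HasDerivWithinAt γ (F (γ t)) (Ici 0) t := by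
  -- The cut-off field is Lipschitz and bounded, and `χ ≥ 0` preserves the pull towards `p`. Its
  -- trajectory therefore stays where `χ = 1` and solves the original equation.
  let χ : ContDiffBump p :=
    ⟨‖x₀ - p‖ + 1, ‖x₀ - p‖ + 2, by positivity, by linarith⟩
  have hG : ContDiff ℝ 1 fun x => χ x • F x := χ.contDiff.smul hF
  have hsupp : HasCompactSupport fun x => χ x • F x := χ.hasCompactSupport.smul_right
  obtain ⟨K, hK⟩ := hG.lipschitzWith_of_hasCompactSupport hsupp one_ne_zero
  obtain ⟨L, hL⟩ := hsupp.exists_bound_of_continuous hG.continuous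
  obtain ⟨γ, h0, hγ⟩ := exists_forall_hasDerivAt_of_lipschitzWith_of_bounded hK
    (L := L.toNNReal) (fun x => (hL x).trans (Real.le_coe_toNNReal L)) x₀
  refine ⟨γ, h0, fun t ht => ?_⟩
  have hmono : ∀ u, ⟪χ u • F u, u - p⟫ ≤ 0 := by
    intro u
    rw [real_inner_smul_left]
    refine mul_nonpos_of_nonneg_of_nonpos χ.nonneg ?_
    rcases eq_or_ne u p with rfl | h
    · simp
    · simpa [hp] using (inner_sub_neg_of_fderiv_neg (hF.differentiable one_ne_zero) hneg h).le
  have hle := norm_sub_sq_le_of_inner_deriv_le (p := p) (c := 0)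
    (fun t _ => (hγ t).hasDerivWithinAt) (fun t _ => by simpa using hmono (γ t)) ht
  have hball : γ t ∈ closedBall p χ.rIn := by
    rw [mem_closedBall, dist_eq_norm]
    have : ‖γ t - p‖ ≤ ‖x₀ - p‖ :=
      (sq_le_sq₀ (norm_nonneg _) (norm_nonneg _)).mp (by simpa [h0] using hle)
    exact this.trans (le_add_of_nonneg_right zero_le_one)
  simpa [χ.one_of_mem_closedBall hball] using (hγ t).hasDerivWithinAt (s := Ici 0)

end NegativeDefinite

/-! ### Angles of a three-circle configuration. -/

section ThreeCircles

/-- Half of `l_ij ^ 2 + l_ik ^ 2 - l_jk ^ 2`, for circles of radii `x`, `y`, `z` at the vertices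
`i`, `j`, `k` and the cosines `p`, `s`, `q` of the weights of `ij`, `ik`, `jk`. -/
def cornerDot (x y z p s q : ℝ) : ℝ :=
  x ^ 2 + x * z * s + x * y * p - y * z * q

/-- Four times the squared area of the triangle of centers of three circles. -/
def areaSq (x y z p s q : ℝ) : ℝ :=
  x ^ 2 * y ^ 2 * (1 - p ^ 2) + x ^ 2 * z ^ 2 * (1 - s ^ 2) + y ^ 2 * z ^ 2 * (1 - q ^ 2)
    + 2 * (x * y * z) * (x * (q + p * s) + y * (s + p * q) + z * (p + q * s))

/-- The squared distance of the centers of two circles. -/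
def lengthSq (x y p : ℝ) : ℝ := x ^ 2 + y ^ 2 + 2 * x * y * p

/-- The angle at the center of the first of three circles. -/
noncomputable def cornerAngle (x y z p s q : ℝ) : ℝ :=
  Real.pi / 2 - Real.arctan (cornerDot x y z p s q / √(areaSq x y z p s q))

/-- The derivative of the angle at the first center with respect to the logarithm of the second
radius. -/
noncomputable def edgeCoeff (x y z p s q : ℝ) : ℝ :=
  x * y * (x * y * (1 - p ^ 2) + z * x * (q + p * s) + z * y * (s + p * q)) /
    (√(areaSq x y z p s q) * lengthSq x y p)

theorem areaSq_swap_left (x y z p s q : ℝ) : areaSq y x z p q s = areaSq x y z p s q := by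
  unfold areaSq; ring

theorem areaSq_swap_right (x y z p s q : ℝ) : areaSq x z y s p q = areaSq x y z p s q := by
  unfold areaSq; ring

theorem edgeCoeff_swap (x y z p s q : ℝ) : edgeCoeff y x z p q s = edgeCoeff x y z p s q := by
  unfold edgeCoeff lengthSq
  rw [areaSq_swap_left]
  congr 1 <;> ring

theorem cornerDot_sq_add_areaSq (x y z p s q : ℝ) :
    cornerDot x y z p s q ^ 2 + areaSq x y z p s q = lengthSq x y p * lengthSq x z s := by
  unfold cornerDot areaSq lengthSq; ring

variable {x y z p s q : ℝ}

theorem lengthSq_pos (hx : 0 < x) (hy : 0 < y) (hp : 0 ≤ p) : 0 < lengthSq x y p := by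
  unfold lengthSq; positivity

/-- Nondegeneracy of the triangle: no term is negative, and either `1 - p ^ 2` or the last term,
through `z * p`, is positive. -/
theorem areaSq_pos (hx : 0 < x) (hy : 0 < y) (hz : 0 < z) (hp : p ∈ Icc (0 : ℝ) 1)
    (hs : s ∈ Icc (0 : ℝ) 1) (hq : q ∈ Icc (0 : ℝ) 1) : 0 < areaSq x y z p s q := by
  obtain ⟨hp0, hp1⟩ := hp
  obtain ⟨hs0, hs1⟩ := hs
  obtain ⟨hq0, hq1⟩ := hq
  have hs2 : 0 ≤ 1 - s ^ 2 := by nlinarith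
  have hq2 : 0 ≤ 1 - q ^ 2 := by nlinarith
  unfold areaSq
  rcases hp1.lt_or_eq with h | rfl
  · have hp2 : 0 < 1 - p ^ 2 := by nlinarith
    positivity
  · have : (0 : ℝ) ≤ 1 - 1 ^ 2 := by norm_num
    positivity

theorem edgeCoeff_nonneg (hx : 0 < x) (hy : 0 < y) (hz : 0 < z) (hp : p ∈ Icc (0 : ℝ) 1)
    (hs : 0 ≤ s) (hq : 0 ≤ q) : 0 ≤ edgeCoeff x y z p s q := by
  obtain ⟨hp0, hp1⟩ := hp
  have hp2 : 0 ≤ 1 - p ^ 2 := by nlinarith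
  have := (lengthSq_pos hx hy hp0).le
  unfold edgeCoeff
  positivity

/-- The excluded case `p = 1`, `s = q = 0` has two tangent circles both orthogonal to the third;
there the coefficient does vanish. -/
theorem edgeCoeff_pos (hx : 0 < x) (hy : 0 < y) (hz : 0 < z) (hp : p ∈ Icc (0 : ℝ) 1)
    (hs : s ∈ Icc (0 : ℝ) 1) (hq : q ∈ Icc (0 : ℝ) 1) (h : p < 1 ∨ 0 < s ∨ 0 < q) :
    0 < edgeCoeff x y z p s q := by
  have hl := lengthSq_pos hx hy hp.1
  have ha := Real.sqrt_pos.mpr (areaSq_pos hx hy hz hp hs hq)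
  obtain ⟨hp0, hp1⟩ := hp
  have hs0 := hs.1
  have hq0 := hq.1
  refine div_pos (mul_pos (mul_pos hx hy) ?_) (mul_pos ha hl)
  rcases hp1.lt_or_eq with hlt | rfl
  · have hp2 : 0 < 1 - p ^ 2 := by nlinarith
    positivity
  · have hsq : 0 < q + s := by
      rcases h with h | h | h
      · exact absurd h (lt_irrefl _)
      · positivity
      · positivity
    have : 0 < z * (q + s) * (x + y) := by positivity
    linarith

/-- The cotangent of the angle is `cornerDot / √areaSq`. Unlike `arccos`, this form has no endpoint
singularities to exclude when differentiating. -/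
theorem arccos_eq_cornerAngle (hx : 0 < x) (hy : 0 < y) (hz : 0 < z) (hp : p ∈ Icc (0 : ℝ) 1)
    (hs : s ∈ Icc (0 : ℝ) 1) (hq : q ∈ Icc (0 : ℝ) 1) :
    Real.arccos ((√(lengthSq x y p) ^ 2 + √(lengthSq x z s) ^ 2 - √(lengthSq y z q) ^ 2) /
      (2 * √(lengthSq x y p) * √(lengthSq x z s))) = cornerAngle x y z p s q := by
  have h1 := lengthSq_pos hx hy hp.1
  have h2 := lengthSq_pos hx hz hs.1
  have h3 := lengthSq_pos hy hz hq.1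
  have hQ := areaSq_pos hx hy hz hp hs hq
  rw [Real.sq_sqrt h1.le, Real.sq_sqrt h2.le, Real.sq_sqrt h3.le, Real.arccos, cornerAngle,
    Real.arctan_eq_arcsin, mul_assoc 2, ← Real.sqrt_mul h1.le, ← cornerDot_sq_add_areaSq x y z p s q]
  congr 2
  have h4 : lengthSq x y p + lengthSq x z s - lengthSq y z q = 2 * cornerDot x y z p s q := by
    unfold lengthSq cornerDot; ring
  have h5 : 1 + (cornerDot x y z p s q / √(areaSq x y z p s q)) ^ 2
      = (cornerDot x y z p s q ^ 2 + areaSq x y z p s q) / areaSq x y z p s q := by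
    rw [div_pow, Real.sq_sqrt hQ.le]
    field_simp
    ring
  have h6 := Real.sqrt_pos.mpr hQ
  have h7 : 0 < √(cornerDot x y z p s q ^ 2 + areaSq x y z p s q) :=
    Real.sqrt_pos.mpr (by positivity)
  rw [h4, h5, Real.sqrt_div' _ hQ.le]
  field_simp

/-- The variation of the angle when the radii change at the logarithmic rates `a`, `b`, `c`. -/
theorem hasDerivAt_cornerAngle {x y z : ℝ → ℝ} {a b c t : ℝ} (hx : HasDerivAt x (x t * a) t)
    (hy : HasDerivAt y (y t * b) t) (hz : HasDerivAt z (z t * c) t) (hx0 : 0 < x t)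
    (hy0 : 0 < y t) (hz0 : 0 < z t) (hp : p ∈ Icc (0 : ℝ) 1) (hs : s ∈ Icc (0 : ℝ) 1)
    (hq : q ∈ Icc (0 : ℝ) 1) :
    HasDerivAt (fun t => cornerAngle (x t) (y t) (z t) p s q)
      (edgeCoeff (x t) (y t) (z t) p s q * (b - a) +
        edgeCoeff (x t) (z t) (y t) s p q * (c - a)) t := by
  have hQ := areaSq_pos hx0 hy0 hz0 hp hs hq
  have h1 := lengthSq_pos hx0 hy0 hp.1
  have h2 := lengthSq_pos hx0 hz0 hs.1
  have hD : HasDerivAt (fun t => cornerDot (x t) (y t) (z t) p s q)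
      (2 * x t ^ 2 * a + x t * z t * s * (a + c) + x t * y t * p * (a + b)
        - y t * z t * q * (b + c)) t := by
    unfold cornerDot
    refine ((((hx.fun_pow 2).fun_add ((hx.fun_mul hz).mul_const s)).fun_add
      ((hx.fun_mul hy).mul_const p)).fun_sub ((hy.fun_mul hz).mul_const q)).congr_deriv ?_
    push_cast
    ring
  have hA : HasDerivAt (fun t => areaSq (x t) (y t) (z t) p s q)
      (2 * x t ^ 2 * y t ^ 2 * (1 - p ^ 2) * (a + b) + 2 * x t ^ 2 * z t ^ 2 * (1 - s ^ 2) * (a + c)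
        + 2 * y t ^ 2 * z t ^ 2 * (1 - q ^ 2) * (b + c)
        + 2 * (x t * y t * z t) * (x t * (q + p * s) * (2 * a + b + c)
          + y t * (s + p * q) * (a + 2 * b + c) + z t * (p + q * s) * (a + b + 2 * c))) t := by
    unfold areaSq
    refine ((((((hx.fun_pow 2).fun_mul (hy.fun_pow 2)).mul_const (1 - p ^ 2)).fun_add
      (((hx.fun_pow 2).fun_mul (hz.fun_pow 2)).mul_const (1 - s ^ 2))).fun_add
      (((hy.fun_pow 2).fun_mul (hz.fun_pow 2)).mul_const (1 - q ^ 2))).fun_add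
      ((((hx.fun_mul hy).fun_mul hz).const_mul 2).fun_mul
        (((hx.mul_const (q + p * s)).fun_add (hy.mul_const (s + p * q))).fun_add
          (hz.mul_const (p + q * s))))).congr_deriv ?_
    push_cast
    ring
  unfold cornerAngle
  refine ((hD.fun_div (hA.sqrt hQ.ne') (Real.sqrt_pos.mpr hQ).ne').arctan.const_sub _).congr_deriv ?_
  have hne := (Real.sqrt_pos.mpr hQ).ne'
  have hsq := Real.sq_sqrt hQ.le
  have hsum := cornerDot_sq_add_areaSq (x t) (y t) (z t) p s q
  unfold edgeCoeff
  rw [areaSq_swap_right (x t) (y t) (z t) p s q]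
  set S := √(areaSq (x t) (y t) (z t) p s q) with hS
  set D := cornerDot (x t) (y t) (z t) p s q with hDdef
  have h3 : 1 + (D / S) ^ 2 = lengthSq (x t) (y t) p * lengthSq (x t) (z t) s / S ^ 2 := by
    rw [← hsum, ← hsq]
    field_simp
    ring
  rw [h3]
  field_simp
  rw [hsq]
  simp only [hDdef, cornerDot, areaSq, lengthSq]
  ring

end ThreeCircles

theorem hasDerivWithinAt_euclidean {ι : Type*} [Fintype ι] {f : ℝ → EuclideanSpace ℝ ι}
    {f' : EuclideanSpace ℝ ι} {s : Set ℝ} {t : ℝ} :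
    HasDerivWithinAt f f' s t ↔ ∀ i, HasDerivWithinAt (fun t => f t i) (f' i) s t := by
  rw [hasDerivWithinAt_iff_hasFDerivWithinAt, hasFDerivWithinAt_euclidean]
  refine forall_congr' fun i => ?_
  rw [hasDerivWithinAt_iff_hasFDerivWithinAt]
  exact Iff.rfl

/-! ### Angle coefficients on the triangulation and their Dirichlet form. -/

namespace WeightedTriangulatedSurface

section LogCoord

variable {V : Type*}

theorem isCirclePackingMetric_exp (u : V → ℝ) :
    IsCirclePackingMetric fun i => Real.exp (u i) := fun i => Real.exp_pos (u i)

/-- Logarithmic coordinates of a circle packing metric. -/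
noncomputable def logCoord (r : V → ℝ) : EuclideanSpace ℝ V :=
  WithLp.toLp 2 fun i => Real.log (r i)

theorem exp_logCoord {r : V → ℝ} (hr : IsCirclePackingMetric r) :
    (fun i => Real.exp (logCoord r i)) = r :=
  funext fun i => Real.exp_log (hr i)

end LogCoord

variable {V : Type*} [Fintype V] [DecidableEq V] (T : WeightedTriangulatedSurface V)

/-- The cosine of the weight of the edge `{i, j}`. -/
noncomputable def cosWeight (i j : V) : ℝ := Real.cos (T.weight s(i, j))

theorem cosWeight_comm (i j : V) : T.cosWeight i j = T.cosWeight j i := by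
  unfold cosWeight; rw [Sym2.eq_swap]

variable {T}

theorem cosWeight_mem {i j : V} (hij : i ≠ j) (h : {i, j} ∈ T.faces) :
    T.cosWeight i j ∈ Icc (0 : ℝ) 1 := by
  obtain ⟨h0, h1⟩ := T.weight_mem i j hij h
  exact ⟨Real.cos_nonneg_of_mem_Icc ⟨by linarith [Real.pi_pos], h1⟩, Real.cos_le_one _⟩

namespace IsTriangle

variable {i j k : V}

theorem swap_right (h : T.IsTriangle i j k) : T.IsTriangle i k j := by
  obtain ⟨h1, h2, h3, h4⟩ := h
  exact ⟨h2, h1, h3.symm, by rwa [Finset.pair_comm k j]⟩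

theorem swap_left (h : T.IsTriangle i j k) : T.IsTriangle j i k := by
  obtain ⟨h1, h2, h3, h4⟩ := h
  exact ⟨h1.symm, h3, h2, by rwa [Finset.insert_comm]⟩

theorem pair_mem (h : T.IsTriangle i j k) : {i, j} ∈ T.faces :=
  (T.isRelLowerSet_faces h.2.2.2).2 (by intro a; simp; tauto) ⟨i, by simp⟩

theorem cosWeight_mem (h : T.IsTriangle i j k) : T.cosWeight i j ∈ Icc (0 : ℝ) 1 :=
  WeightedTriangulatedSurface.cosWeight_mem h.1 h.pair_mem

theorem cosWeight_mem' (h : T.IsTriangle i j k) : T.cosWeight i k ∈ Icc (0 : ℝ) 1 :=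
  h.swap_right.cosWeight_mem

theorem cosWeight_mem'' (h : T.IsTriangle i j k) : T.cosWeight j k ∈ Icc (0 : ℝ) 1 :=
  h.swap_left.cosWeight_mem'

end IsTriangle

theorem isTriangle_swap_right {i j k : V} : T.IsTriangle i j k ↔ T.IsTriangle i k j :=
  ⟨.swap_right, .swap_right⟩

theorem isTriangle_swap_left {i j k : V} : T.IsTriangle i j k ↔ T.IsTriangle j i k :=
  ⟨.swap_left, .swap_left⟩

theorem exists_isTriangle {i j : V} (hij : i ≠ j) (h : {i, j} ∈ T.faces) :
    ∃ k, T.IsTriangle i j k := by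
  have hc := T.edge_two_triangles i j hij h
  obtain ⟨k, hk1, hk2, hk3⟩ := nonempty_of_ncard_ne_zero (hc ▸ two_ne_zero)
  exact ⟨k, hij, hk1.symm, hk2.symm, hk3⟩

/-- A function that agrees on the vertices of every triangle is constant. -/
theorem eq_of_forall_isTriangle {β : Type*} {w : V → β}
    (h : ∀ i j k, T.IsTriangle i j k → w i = w j) (i j : V) : w i = w j := by
  obtain ⟨p⟩ := T.connected.preconnected i j
  induction p with
  | nil => rfl
  | cons hadj _ ih =>
    refine Eq.trans ?_ ih
    obtain ⟨hne, h1 | h1⟩ := (SimpleGraph.fromRel_adj _ _ _).mp hadj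
    · obtain ⟨k, hk⟩ := exists_isTriangle hne h1
      exact h _ _ _ hk
    · obtain ⟨k, hk⟩ := exists_isTriangle hne.symm h1
      exact (h _ _ _ hk).symm

variable (T) in
/-- The derivative of the angle at `i` in the triangle `ijk` with respect to `log r_j`. -/
noncomputable def angleCoeff (r : V → ℝ) (i j k : V) : ℝ :=
  edgeCoeff (r i) (r j) (r k) (T.cosWeight i j) (T.cosWeight i k) (T.cosWeight j k)

theorem angleCoeff_swap (r : V → ℝ) (i j k : V) :
    T.angleCoeff r j i k = T.angleCoeff r i j k := by
  unfold angleCoeff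
  rw [T.cosWeight_comm j i, edgeCoeff_swap]

section Angles

variable {r : V → ℝ} {i j k : V}

theorem innerAngle_eq_cornerAngle (hr : IsCirclePackingMetric r) (h : T.IsTriangle i j k) :
    T.innerAngle r i j k = cornerAngle (r i) (r j) (r k)
      (T.cosWeight i j) (T.cosWeight i k) (T.cosWeight j k) :=
  arccos_eq_cornerAngle (hr i) (hr j) (hr k) h.cosWeight_mem h.cosWeight_mem' h.cosWeight_mem''

theorem angleCoeff_nonneg (hr : IsCirclePackingMetric r) (h : T.IsTriangle i j k) :
    0 ≤ T.angleCoeff r i j k :=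
  edgeCoeff_nonneg (hr i) (hr j) (hr k) h.cosWeight_mem h.cosWeight_mem'.1 h.cosWeight_mem''.1

theorem angleCoeff_pos (hr : IsCirclePackingMetric r) (h : T.IsTriangle i j k)
    (hc : T.cosWeight i j < 1 ∨ 0 < T.cosWeight i k ∨ 0 < T.cosWeight j k) :
    0 < T.angleCoeff r i j k :=
  edgeCoeff_pos (hr i) (hr j) (hr k) h.cosWeight_mem h.cosWeight_mem' h.cosWeight_mem'' hc

/-- If `w` varies only along edges with vanishing coefficient, then `w` agrees on the vertices of
every triangle. -/
theorem eq_of_angleCoeff_eq_zero_or (hr : IsCirclePackingMetric r) {w : V → ℝ}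
    (hw : ∀ i j k, T.IsTriangle i j k → T.angleCoeff r i j k = 0 ∨ w i = w j)
    (h : T.IsTriangle i j k) : w i = w j := by
  by_cases hc : T.cosWeight i j < 1 ∨ 0 < T.cosWeight i k ∨ 0 < T.cosWeight j k
  · exact (hw i j k h).resolve_left (angleCoeff_pos hr h hc).ne'
  -- The coefficient of `ij` may vanish, but then `ik` and `jk` have cosine at most `0`, hence
  -- positive coefficients, and `w` is compared through `k`.
  · push Not at hc
    have h1 := (hw i k j h.swap_right).resolve_left
      (angleCoeff_pos hr h.swap_right (Or.inl (by linarith))).ne'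
    have h2 := (hw j k i h.swap_left.swap_right).resolve_left
      (angleCoeff_pos hr h.swap_left.swap_right (Or.inl (by linarith))).ne'
    exact h1.trans h2.symm

end Angles

open Classical in
/-- The quadratic form of the derivative of the curvature is the Dirichlet form of the weights
`angleCoeff`. -/
theorem sum_mul_sum_angleCoeff (r w : V → ℝ) :
    ∑ i, w i * ∑ j, ∑ k, (if T.IsTriangle i j k then
        T.angleCoeff r i j k * (w j - w i) + T.angleCoeff r i k j * (w k - w i) else 0) =
      -∑ i, ∑ j, ∑ k,
        if T.IsTriangle i j k then T.angleCoeff r i j k * (w i - w j) ^ 2 else 0 := by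
  have h1 : ∑ i, w i * ∑ j, ∑ k, (if T.IsTriangle i j k then
        T.angleCoeff r i j k * (w j - w i) + T.angleCoeff r i k j * (w k - w i) else 0) =
      ∑ i, ∑ j, ∑ k, (if T.IsTriangle i j k then T.angleCoeff r i j k * (w j - w i) * w i else 0) +
      ∑ i, ∑ j, ∑ k,
        (if T.IsTriangle i j k then T.angleCoeff r i k j * (w k - w i) * w i else 0) := by
    simp only [Finset.mul_sum, ← Finset.sum_add_distrib]
    refine Finset.sum_congr rfl fun i _ => Finset.sum_congr rfl fun j _ =>
      Finset.sum_congr rfl fun k _ => ?_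
    split_ifs <;> ring
  have h2 : ∑ i, ∑ j, ∑ k,
        (if T.IsTriangle i j k then T.angleCoeff r i k j * (w k - w i) * w i else 0) =
      ∑ i, ∑ j, ∑ k,
        (if T.IsTriangle i j k then T.angleCoeff r i j k * (w j - w i) * w i else 0) := by
    refine Finset.sum_congr rfl fun i _ => ?_
    rw [Finset.sum_comm]
    exact Finset.sum_congr rfl fun j _ => Finset.sum_congr rfl fun k _ =>
      if_congr isTriangle_swap_right rfl rfl
  have h3 : ∑ i, ∑ j, ∑ k,
        (if T.IsTriangle i j k then T.angleCoeff r i j k * (w j - w i) * w i else 0) =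
      ∑ i, ∑ j, ∑ k,
        (if T.IsTriangle i j k then T.angleCoeff r i j k * (w i - w j) * w j else 0) := by
    rw [Finset.sum_comm]
    refine Finset.sum_congr rfl fun i _ => Finset.sum_congr rfl fun j _ =>
      Finset.sum_congr rfl fun k _ => ?_
    rw [angleCoeff_swap]
    exact if_congr isTriangle_swap_left rfl rfl
  rw [h1, h2]
  -- Only one of the two equal sums is reindexed by `i ↔ j`; adding the copies completes the square
  -- `-(w i - w j) ^ 2`.
  nth_rewrite 1 [h3]
  simp only [← Finset.sum_add_distrib, ← Finset.sum_neg_distrib]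
  refine Finset.sum_congr rfl fun i _ => Finset.sum_congr rfl fun j _ =>
    Finset.sum_congr rfl fun k _ => ?_
  split_ifs <;> ring

/-! ### The flow field in logarithmic coordinates. -/

section LogarithmicCoordinates

theorem contDiff_innerAngle_exp {i j k : V} (h : T.IsTriangle i j k) :
    ContDiff ℝ 1 fun u : EuclideanSpace ℝ V => T.innerAngle (fun i => Real.exp (u i)) i j k := by
  simp only [innerAngle_eq_cornerAngle (isCirclePackingMetric_exp _) h]
  have hpos : ∀ u : EuclideanSpace ℝ V, 0 < areaSq (Real.exp (u i)) (Real.exp (u j))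
      (Real.exp (u k)) (T.cosWeight i j) (T.cosWeight i k) (T.cosWeight j k) := fun u =>
    areaSq_pos (Real.exp_pos _) (Real.exp_pos _) (Real.exp_pos _) h.cosWeight_mem
      h.cosWeight_mem' h.cosWeight_mem''
  have hD : ContDiff ℝ 1 fun u : EuclideanSpace ℝ V => cornerDot (Real.exp (u i)) (Real.exp (u j))
      (Real.exp (u k)) (T.cosWeight i j) (T.cosWeight i k) (T.cosWeight j k) := by
    unfold cornerDot; fun_prop
  have hA : ContDiff ℝ 1 fun u : EuclideanSpace ℝ V => areaSq (Real.exp (u i)) (Real.exp (u j))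
      (Real.exp (u k)) (T.cosWeight i j) (T.cosWeight i k) (T.cosWeight j k) := by
    unfold areaSq; fun_prop
  exact contDiff_const.sub (Real.contDiff_arctan.comp
    (hD.div (hA.sqrt fun u => (hpos u).ne') fun u => (Real.sqrt_pos.mpr (hpos u)).ne'))

theorem contDiff_gaussCurvature_exp (i : V) :
    ContDiff ℝ 1 fun u : EuclideanSpace ℝ V => T.gaussCurvature (fun i => Real.exp (u i)) i := by
  unfold gaussCurvature
  refine contDiff_const.sub (contDiff_const.mul (ContDiff.sum fun j _ => ContDiff.sum fun k _ => ?_))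
  split_ifs with h
  · exact contDiff_innerAngle_exp h
  · exact contDiff_const

theorem hasDerivAt_innerAngle_exp {i j k : V} (h : T.IsTriangle i j k)
    (u w : EuclideanSpace ℝ V) :
    HasDerivAt (fun t : ℝ => T.innerAngle (fun i => Real.exp ((u + t • w) i)) i j k)
      (T.angleCoeff (fun i => Real.exp (u i)) i j k * (w j - w i) +
        T.angleCoeff (fun i => Real.exp (u i)) i k j * (w k - w i)) 0 := by
  simp only [innerAngle_eq_cornerAngle (isCirclePackingMetric_exp _) h]
  have hexp : ∀ i : V, HasDerivAt (fun t : ℝ => Real.exp ((u + t • w) i))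
      (Real.exp ((u + (0 : ℝ) • w) i) * w i) 0 := by
    intro i
    have : HasDerivAt (fun t : ℝ => (u + t • w) i) (w i) 0 := by
      simpa using ((hasDerivAt_id (0 : ℝ)).mul_const (w i)).const_add (u i)
    exact this.exp
  refine (hasDerivAt_cornerAngle (hexp i) (hexp j) (hexp k) (Real.exp_pos _) (Real.exp_pos _)
    (Real.exp_pos _) h.cosWeight_mem h.cosWeight_mem' h.cosWeight_mem'').congr_deriv ?_
  simp only [angleCoeff, zero_smul, add_zero, T.cosWeight_comm k j]

open Classical in
theorem hasDerivAt_gaussCurvature_exp (i : V) (u w : EuclideanSpace ℝ V) :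
    HasDerivAt (fun t : ℝ => T.gaussCurvature (fun i => Real.exp ((u + t • w) i)) i)
      (-(1 / 2 * ∑ j, ∑ k, (if T.IsTriangle i j k then
        T.angleCoeff (fun i => Real.exp (u i)) i j k * (w j - w i) +
          T.angleCoeff (fun i => Real.exp (u i)) i k j * (w k - w i) else 0))) 0 := by
  unfold gaussCurvature
  refine ((HasDerivAt.fun_sum fun j _ => HasDerivAt.fun_sum fun k _ => ?_).const_mul _).const_sub _
  split_ifs with h
  · exact hasDerivAt_innerAngle_exp h u w
  · exact hasDerivAt_const _ _

variable (T) in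
/-- The vector field of the modified `α`-flow in the coordinates `u i = log (r i)`. -/
noncomputable def alphaField (α : ℝ) (R : V → ℝ) (u : EuclideanSpace ℝ V) : EuclideanSpace ℝ V :=
  WithLp.toLp 2 fun i =>
    R i * Real.exp (u i) ^ α - T.gaussCurvature (fun i => Real.exp (u i)) i

theorem contDiff_alphaField (α : ℝ) (R : V → ℝ) : ContDiff ℝ 1 (T.alphaField α R) := by
  rw [contDiff_euclidean]
  intro i
  unfold alphaField
  refine ContDiff.sub ?_ (contDiff_gaussCurvature_exp i)
  refine contDiff_const.mul (ContDiff.rpow_const_of_ne (by fun_prop) fun u => (Real.exp_pos _).ne')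

theorem inner_fderiv_alphaField (α : ℝ) (R : V → ℝ) (u w : EuclideanSpace ℝ V) :
    open Classical in
    ⟪fderiv ℝ (T.alphaField α R) u w, w⟫ = ∑ i, α * R i * Real.exp (u i) ^ α * w i ^ 2 -
      1 / 2 * ∑ i, ∑ j, ∑ k, if T.IsTriangle i j k then
        T.angleCoeff (fun i => Real.exp (u i)) i j k * (w i - w j) ^ 2 else 0 := by
  classical
  have hline : HasDerivAt (fun t : ℝ => u + t • w) w 0 := by
    simpa using ((hasDerivAt_id (0 : ℝ)).smul_const w).const_add u
  have h1 : HasDerivAt (fun t : ℝ => T.alphaField α R (u + t • w))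
      (fderiv ℝ (T.alphaField α R) u w) 0 := by
    have := ((contDiff_alphaField (T := T) α R).differentiable one_ne_zero
      (u + (0 : ℝ) • w)).hasFDerivAt.comp_hasDerivAt (0 : ℝ) hline
    simp only [zero_smul, add_zero] at this
    exact this
  have h2 : ∀ i, fderiv ℝ (T.alphaField α R) u w i = α * R i * Real.exp (u i) ^ α * w i +
      1 / 2 * ∑ j, ∑ k, (if T.IsTriangle i j k then
        T.angleCoeff (fun i => Real.exp (u i)) i j k * (w j - w i) +
          T.angleCoeff (fun i => Real.exp (u i)) i k j * (w k - w i) else 0) := by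
    intro i
    have h3 : HasDerivAt (fun t : ℝ => R i * Real.exp ((u + t • w) i) ^ α)
        (α * R i * Real.exp (u i) ^ α * w i) 0 := by
      have h4 : HasDerivAt (fun t : ℝ => (u + t • w) i * α) (w i * α) 0 := by
        simpa using (((hasDerivAt_id (0 : ℝ)).mul_const (w i)).const_add (u i)).mul_const α
      simp only [← Real.exp_mul]
      refine (h4.exp.const_mul (R i)).congr_deriv ?_
      simp
      ring
    have h5 := (hasDerivWithinAt_euclidean.mp h1.hasDerivWithinAt i |>.hasDerivAt univ_mem).unique
      (h3.sub (hasDerivAt_gaussCurvature_exp i u w))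
    rw [h5]
    ring
  rw [PiLp.inner_apply]
  simp only [h2, RCLike.inner_apply, conj_trivial]
  have h6 := sum_mul_sum_angleCoeff (T := T) (fun i => Real.exp (u i)) w
  rw [← neg_eq_iff_eq_neg] at h6
  rw [← h6, mul_neg, sub_neg_eq_add, Finset.mul_sum, ← Finset.sum_add_distrib]
  refine Finset.sum_congr rfl fun i _ => ?_
  ring

/-- Both parts of the form are nonpositive. If they vanish, the Dirichlet part forces `w` constant,
and the diagonal part forces `w i = 0` where `α * R i ≠ 0`. -/
theorem inner_fderiv_alphaField_neg {α : ℝ} {R : V → ℝ} (hR : ∀ i, α * R i ≤ 0)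
    (hR_ne : ∃ i, α * R i ≠ 0) (u w : EuclideanSpace ℝ V) (hw : w ≠ 0) :
    ⟪fderiv ℝ (T.alphaField α R) u w, w⟫ < 0 := by
  classical
  rw [inner_fderiv_alphaField]
  have hr := isCirclePackingMetric_exp u
  have hterm : ∀ i, α * R i * Real.exp (u i) ^ α * w i ^ 2 ≤ 0 := fun i =>
    mul_nonpos_of_nonpos_of_nonneg (mul_nonpos_of_nonpos_of_nonneg (hR i) (by positivity))
      (sq_nonneg _)
  have htri : ∀ i j k, 0 ≤ if T.IsTriangle i j k then
      T.angleCoeff (fun i => Real.exp (u i)) i j k * (w i - w j) ^ 2 else 0 := by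
    intro i j k
    split_ifs with h
    · exact mul_nonneg (angleCoeff_nonneg hr h) (sq_nonneg _)
    · exact le_rfl
  have htri' : ∀ i, 0 ≤ ∑ j, ∑ k, if T.IsTriangle i j k then
      T.angleCoeff (fun i => Real.exp (u i)) i j k * (w i - w j) ^ 2 else 0 := fun i =>
    Finset.sum_nonneg fun j _ => Finset.sum_nonneg fun k _ => htri i j k
  have hA := Finset.sum_nonpos fun i (_ : i ∈ Finset.univ) => hterm i
  have hB := Finset.sum_nonneg fun i (_ : i ∈ Finset.univ) => htri' i
  refine lt_of_le_of_ne (by linarith) fun h0 => hw ?_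
  have hA0 := (Finset.sum_eq_zero_iff_of_nonpos fun i _ => hterm i).mp (by linarith)
  have hB0 := (Finset.sum_eq_zero_iff_of_nonneg fun i _ => htri' i).mp (by linarith)
  have hconst : ∀ i j, w i = w j := by
    refine eq_of_forall_isTriangle (T := T) fun i j k h =>
      eq_of_angleCoeff_eq_zero_or hr (fun i j k h => ?_) h
    have h1 := (Finset.sum_eq_zero_iff_of_nonneg fun j _ =>
      Finset.sum_nonneg fun k _ => htri i j k).mp (hB0 i (Finset.mem_univ i)) j (Finset.mem_univ j)
    have h2 := (Finset.sum_eq_zero_iff_of_nonneg fun k _ => htri i j k).mp h1 k (Finset.mem_univ k)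
    rw [if_pos h] at h2
    exact (mul_eq_zero.mp h2).imp id fun h => sub_eq_zero.mp (pow_eq_zero_iff two_ne_zero |>.mp h)
  obtain ⟨i, hi⟩ := hR_ne
  have hi0 : w i = 0 := by
    have := hA0 i (Finset.mem_univ i)
    simpa [hi, (Real.rpow_pos_of_pos (Real.exp_pos (u i)) α).ne'] using this
  ext j
  rw [hconst j i, hi0]
  rfl

theorem alphaField_logCoord {α : ℝ} {R r : V → ℝ} (hr : IsCirclePackingMetric r) (i : V) :
    T.alphaField α R (logCoord r) i = R i * r i ^ α - T.gaussCurvature r i := by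
  change R i * Real.exp (logCoord r i) ^ α -
    T.gaussCurvature (fun i => Real.exp (logCoord r i)) i = _
  rw [exp_logCoord hr, congrFun (exp_logCoord hr) i]

theorem alphaField_logCoord_eq_zero {α : ℝ} {R r : V → ℝ} (hr : IsCirclePackingMetric r)
    (h : T.alphaCurvature α r = R) : T.alphaField α R (logCoord r) = 0 := by
  ext i
  rw [alphaField_logCoord hr, ← h, alphaCurvature,
    div_mul_cancel₀ _ (Real.rpow_pos_of_pos (hr i) α).ne', sub_self]
  rfl

theorem IsModifiedAlphaFlow.hasDerivWithinAt {α : ℝ} {R : V → ℝ} {r : ℝ → V → ℝ}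
    (h : T.IsModifiedAlphaFlow α R r) (t : ℝ) (ht : 0 ≤ t) :
    HasDerivWithinAt (fun s => logCoord (r s)) (T.alphaField α R (logCoord (r t))) (Ici 0) t := by
  rw [hasDerivWithinAt_euclidean]
  intro i
  rw [alphaField_logCoord (h.metric t ht)]
  exact h.flow t ht i

theorem isModifiedAlphaFlow_exp {α : ℝ} {R : V → ℝ} {γ : ℝ → EuclideanSpace ℝ V}
    (h : ∀ t, 0 ≤ t → HasDerivWithinAt γ (T.alphaField α R (γ t)) (Ici 0) t) :
    T.IsModifiedAlphaFlow α R fun t i => Real.exp (γ t i) where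
  metric t _ := isCirclePackingMetric_exp (γ t)
  flow t ht i := by
    simp only [Real.log_exp]
    exact hasDerivWithinAt_euclidean.mp (h t ht) i

end LogarithmicCoordinates

end WeightedTriangulatedSurface

/-! ### Return to the radii and the main theorem. -/

/-- The exponential function is Lipschitz below any bound. -/
theorem Real.abs_exp_sub_exp_le {a b m : ℝ} (ha : a ≤ m) (hb : b ≤ m) :
    |Real.exp a - Real.exp b| ≤ Real.exp m * |a - b| := by
  have := (convex_Iic m).norm_image_sub_le_of_norm_deriv_le (f := Real.exp) (C := Real.exp m)
    (fun x _ => Real.differentiableAt_exp) (fun x hx => by simpa using hx) hb ha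
  simpa using this

open WeightedTriangulatedSurface in
theorem mainTheorem4 {V : Type*} [Fintype V] [DecidableEq V] (T : WeightedTriangulatedSurface V)
    (α : ℝ) (R : V → ℝ)
    (hR : ∀ i, α * R i ≤ 0) (hR_ne : ∃ i, α * R i ≠ 0)
    (rbar : V → ℝ) (hrbar : WeightedTriangulatedSurface.IsCirclePackingMetric rbar)
    (hcurv : T.alphaCurvature α rbar = R) :
    (∀ r : V → ℝ, WeightedTriangulatedSurface.IsCirclePackingMetric r →
      T.alphaCurvature α r = R → r = rbar) ∧
    (∀ r₀ : V → ℝ, WeightedTriangulatedSurface.IsCirclePackingMetric r₀ →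
      (∃ r : ℝ → V → ℝ, T.IsModifiedAlphaFlow α R r ∧ r 0 = r₀) ∧
      ∀ r : ℝ → V → ℝ, T.IsModifiedAlphaFlow α R r → r 0 = r₀ →
        ∃ C c : ℝ, 0 < c ∧ ∀ t, 0 ≤ t → ∀ i, |r t i - rbar i| ≤ C * Real.exp (-c * t)) := by
  have hF := contDiff_alphaField (T := T) α R
  have hneg := inner_fderiv_alphaField_neg (T := T) hR hR_ne
  have hzero := alphaField_logCoord_eq_zero hrbar hcurv
  refine ⟨fun r hr h => ?_, fun r₀ hr₀ => ⟨?_, fun r hr _ => ?_⟩⟩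
  · by_contra hne
    have hne' : logCoord r ≠ logCoord rbar := fun h' => hne (by
      rw [← exp_logCoord hr, h', exp_logCoord hrbar])
    have := inner_sub_neg_of_fderiv_neg (hF.differentiable one_ne_zero) hneg hne'
    rw [hzero, alphaField_logCoord_eq_zero hr h] at this
    simp at this
  · obtain ⟨γ, h0, hγ⟩ := exists_forall_hasDerivWithinAt_Ici hF hneg hzero (logCoord r₀)
    exact ⟨_, isModifiedAlphaFlow_exp hγ, by simp only [h0, exp_logCoord hr₀]⟩
  · obtain ⟨c, hc, hdecay⟩ := exists_norm_sub_le_exp hF hneg hzero hr.hasDerivWithinAt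
    set ρ := ‖logCoord (r 0) - logCoord rbar‖ with hρ
    have hρ0 : 0 ≤ ρ := norm_nonneg _
    -- All logarithms involved are at most `‖logCoord rbar‖ + ρ`, so the first factor is a Lipschitz
    -- constant of `exp` there.
    refine ⟨Real.exp (‖logCoord rbar‖ + ρ) * ρ, c, hc, fun t ht i => ?_⟩
    have hi : |Real.log (r t i) - Real.log (rbar i)| ≤ ρ * Real.exp (-c * t) :=
      (PiLp.norm_apply_le (logCoord (r t) - logCoord rbar) i).trans (hdecay t ht)
    have he : Real.exp (-c * t) ≤ 1 := Real.exp_le_one_iff.mpr (by nlinarith)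
    have hb : Real.log (rbar i) ≤ ‖logCoord rbar‖ :=
      (le_abs_self _).trans (PiLp.norm_apply_le (logCoord rbar) i)
    have hb' : Real.log (r t i) ≤ ‖logCoord rbar‖ + ρ := by
      have := (le_abs_self _).trans hi
      nlinarith
    have := Real.abs_exp_sub_exp_le hb' (hb.trans (le_add_of_nonneg_right hρ0))
    rw [Real.exp_log (hr.metric t ht i), Real.exp_log (hrbar i)] at this
    rw [mul_assoc]
    exact this.trans (by gcongr)
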